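/- Let $\mathbb{F}$ be an algebraically closed field. A \emph{minimal basis} of a subspace $\mathcal V\subseteq\mathbb F(\lambda)^k$ is a basis of $\mathcal V$ consisting of polynomial vectors whose sum of degrees (the degree of a vector being the largest degree of its entries) is minimal among all bases of $\mathcal V$ consisting of polynomial vectors; the increasingly ordered degrees of its vectors are the \emph{minimal indices} of $\mathcal V$. The right minimal bases and right minimal indices of a rational matrix $T(\lambda)$ are those of $\{x\in\mathbb F(\lambda)^{k}:T x=0\}$, where $k$ is the number of columns of $T$. A polynomial matrix is called a minimal basis if its rows form a minimal basis of the subspace they span. Minimal bases $K(\lambda)\in\mathbb F[\lambda]^{q\times k}$ and $N(\lambda)\in\mathbb F[\lambda]^{r\times k}$ are \emph{dual} if $q+r=k$ and $K N^T=0$. A linear polynomial matrix (degree at most $1$) $\left[\begin{smallmatrix}M(\lambda)\\K(\lambda)\end{smallmatrix}\right]$ is a \emph{strong block minimal basis pencil} associated with a polynomial matrix $P(\lambda)$, with dual minimal basis $N(\lambda)$ of degree $\rho$, if $K$ and $N$ are dual minimal bases, all rows of $K$ have degree $1$, all rows of $N$ have degree $\rho$, and $M N^T=P$. Let $R(\lambda)=D(\lambda)+C(\lambda)A(\lambda)^{-1}B(\lambda)\in\mathbb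 F(\lambda)^{p\times m}$ with polynomial matrices $A\in\mathbb F[\lambda]^{n\times n}$ nonsingular ($\det A\not\equiv 0$), $B\in\mathbb F[\lambda]^{n\times m}$, $C\in\mathbb F[\lambda]^{p\times n}$, $D\in\mathbb F[\lambda]^{p\times m}$. Let $L_A=\left[\begin{smallmatrix}M_A\\K_A\end{smallmatrix}\right]$ and $L_D=\left[\begin{smallmatrix}M_D\\K_D\end{smallmatrix}\right]$ be strong block minimal basis pencils associated with $A$ and $D$, with dual minimal bases $N_A\in\mathbb F[\lambda]^{n\times(\rho_A+1)n}$ and $N_D\in\mathbb F[\lambda]^{m\times(\rho_D+1)m}$ of degrees $\rho_A$ and $\rho_D$, respectively. Let $M_B$, $M_C$ be linear polynomial matrices with $M_C N_A^T=C$ and $M_B N_D^T=B$, put $$\mathcal L(\lambda)=\left[\begin{array}{c|c} M_A(\lambda)&M_B(\lambda)\\K_A(\lambda)&0\\\hline -M_C(\lambda)&M_D(\lambda)\\0&K_D(\lambda)\end{array}\right]\in\mathbb F[\lambda]^{(n+p+\rho_An+\rho_Dm)\times(n+m+\rho_An+\rho_Dm)},$$ and let $$\widehat R(\lambda)=\begin{bmatrix}M_D\\K_D\end{bmatrix}+\begin{bmatrix}M_C\\0\end{bmatrix}\begin{bmatrix}M_A\\K_A\end{bmatrix}^{-1}\begin{bmatrix}M_B\\0\end{bmatrix}$$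 be its transfer function matrix. Write $\mathrm{rev}_dP(\lambda)=\lambda^dP(1/\lambda)$ for a polynomial matrix $P$ of degree at most $d$. Assume $$\mathrm{rank}\begin{bmatrix}A(\lambda_0)\\C(\lambda_0)\end{bmatrix}=n\ \text{ for all }\lambda_0\in\mathbb F,\qquad \mathrm{rank}\begin{bmatrix}\mathrm{rev}_{\rho_A+1}A(0)\\\mathrm{rev}_{\rho_A+1}C(0)\end{bmatrix}=n .$$ Then: (a) If $\left\{\left[\begin{smallmatrix}y_i(\lambda)\\x_i(\lambda)\end{smallmatrix}\right]\right\}_{i=1}^s$ is a right minimal basis of $\mathcal L(\lambda)$, where $x_i(\lambda)\in\mathbb F[\lambda]^{(\rho_D+1)m}$, then $\{x_i(\lambda)\}_{i=1}^s$ is a right minimal basis of $\widehat R(\lambda)$, and there is a right minimal basis $\{u_i(\lambda)\}_{i=1}^s$ of $R(\lambda)$ such that $x_i(\lambda)=N_D(\lambda)^Tu_i(\lambda)$ for $i=1,\dots,s$. (b) If $\epsilon_1\le\cdots\le\epsilon_s$ are the right minimal indices of $\mathcal L(\lambda)$, then $\epsilon_1\le\cdots\le\epsilon_s$ are the right minimal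 indices of $\widehat R(\lambda)$, and $\epsilon_1-\rho_D\le\cdots\le\epsilon_s-\rho_D$ (all nonnegative) are the right minimal indices of $R(\lambda)$. -/

import Mathlib

open Polynomial

namespace RationalLinearization

noncomputable section

/-- The degree of a polynomial vector: the largest degree of its entries
(the zero vector gets degree `0`; it never occurs in a basis). -/
def vecDegree {F : Type*} [Field F] {ν : Type*} [Fintype ν] (v : ν → F[X]) : ℕ :=
  Finset.univ.sup fun j => (v j).natDegree

/-- A polynomial vector, regarded as a vector of rational functions. -/
def vecToRat {F : Type*} [Field F] {ν : Type*} (v : ν → F[X]) : ν → RatFunc F :=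
  fun j => algebraMap F[X] (RatFunc F) (v j)

/-- A polynomial matrix, regarded as a rational matrix. -/
def matToRat {F : Type*} [Field F] {μ ν : Type*} (P : Matrix μ ν F[X]) :
    Matrix μ ν (RatFunc F) :=
  P.map (algebraMap F[X] (RatFunc F))

/-- `b` is a polynomial basis of the rational subspace `V`. -/
def IsPolynomialBasis {F : Type*} [Field F] {ι ν : Type*}
    (V : Submodule (RatFunc F) (ν → RatFunc F)) (b : ι → ν → F[X]) : Prop :=
  LinearIndependent (RatFunc F) (fun i => vecToRat (b i)) ∧
    Submodule.span (RatFunc F) (Set.range fun i => vecToRat (b i)) = V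

/-- `b` is a minimal basis of the rational subspace `V`: a polynomial basis whose sum of degrees
is minimal among all polynomial bases of `V` (all bases of `V` have the same cardinality, so they
may be indexed by the same type). -/
def IsMinimalBasis {F : Type*} [Field F] {ι ν : Type*} [Fintype ι] [Fintype ν]
    (V : Submodule (RatFunc F) (ν → RatFunc F)) (b : ι → ν → F[X]) : Prop :=
  IsPolynomialBasis V b ∧
    ∀ b' : ι → ν → F[X], IsPolynomialBasis V b' →
      ∑ i, vecDegree (b i) ≤ ∑ i, vecDegree (b' i)

/-- `ε₁ ≤ ⋯ ≤ εₛ` are the minimal indices of the rational subspace `V`: the ordered list of the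
degrees of the vectors of a minimal basis of `V`. -/
def AreMinimalIndices {F : Type*} [Field F] {ν : Type*} [Fintype ν]
    (V : Submodule (RatFunc F) (ν → RatFunc F)) {s : ℕ} (ε : Fin s → ℕ) : Prop :=
  Monotone ε ∧
    ∃ b : Fin s → ν → F[X], IsMinimalBasis V b ∧ ∀ i, vecDegree (b i) = ε i

/-- The right null-space `{x : R x = 0}` of a rational matrix. -/
def rightNullSpace {F : Type*} [Field F] {μ ν : Type*} [Fintype ν]
    (R : Matrix μ ν (RatFunc F)) : Submodule (RatFunc F) (ν → RatFunc F) :=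
  LinearMap.ker R.mulVecLin

/-- Right minimal bases of a rational matrix. -/
def IsRightMinimalBasis {F : Type*} [Field F] {ι μ ν : Type*} [Fintype ι] [Fintype ν]
    (R : Matrix μ ν (RatFunc F)) (b : ι → ν → F[X]) : Prop :=
  IsMinimalBasis (rightNullSpace R) b

/-- Right minimal indices of a rational matrix. -/
def AreRightMinimalIndices {F : Type*} [Field F] {μ ν : Type*} [Fintype ν]
    (R : Matrix μ ν (RatFunc F)) {s : ℕ} (ε : Fin s → ℕ) : Prop :=
  AreMinimalIndices (rightNullSpace R) ε

/-- A polynomial matrix is a minimal basis (by rows) if its rows form a minimal basis of the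
rational subspace that they span. -/
def IsRowMinimalBasis {F : Type*} [Field F] {κ ν : Type*} [Fintype κ] [Fintype ν]
    (K : Matrix κ ν F[X]) : Prop :=
  IsMinimalBasis (Submodule.span (RatFunc F) (Set.range fun i => vecToRat (K i)))
    (fun i => K i)

/-- `K` and `N` are dual minimal bases. -/
structure AreDualMinimalBases {F : Type*} [Field F] {κ μ ν : Type*}
    [Fintype κ] [Fintype μ] [Fintype ν]
    (K : Matrix κ ν F[X]) (N : Matrix μ ν F[X]) : Prop where
  left_minimal : IsRowMinimalBasis K
  right_minimal : IsRowMinimalBasis N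
  card_add : Fintype.card κ + Fintype.card μ = Fintype.card ν
  mul_transpose : K * N.transpose = 0

/-- A linear polynomial matrix `λ M₁ + M₀`. -/
def IsLinearMatrix {F : Type*} [Field F] {μ ν : Type*} (M : Matrix μ ν F[X]) : Prop :=
  ∀ i j, (M i j).natDegree ≤ 1

/-- `[M; K]` is a (degenerate, that is, one block column) strong block minimal basis pencil
associated with the polynomial matrix `P`, where `N` is a minimal basis dual to `K`, and `ρ` is the
common degree of the rows of `N`, so that `ρ = deg N`. -/
structure IsStrongBlockMinimalBasisPencil {F : Type*} [Field F] {ι κ μ ν : Type*}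
    [Fintype κ] [Fintype μ] [Fintype ν]
    (M : Matrix ι ν F[X]) (K : Matrix κ ν F[X]) (N : Matrix μ ν F[X]) (ρ : ℕ)
    (P : Matrix ι μ F[X]) : Prop where
  linear_top : IsLinearMatrix M
  linear_bottom : IsLinearMatrix K
  dual : AreDualMinimalBases K N
  rowDegree_bottom : ∀ i, vecDegree (K i) = 1
  rowDegree_dual : ∀ i, vecDegree (N i) = ρ
  associated : M * N.transpose = P

/-- The transfer function matrix of a polynomial system matrix `[A, B; -C, D]`: the Schur
complement `D + C A⁻¹ B` of the state matrix `A`. -/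
def transferFunction {F : Type*} [Field F] {α β γ : Type*} [Fintype α] [DecidableEq α]
    (P : Matrix (α ⊕ β) (α ⊕ γ) F[X]) : Matrix β γ (RatFunc F) :=
  matToRat P.toBlocks₂₂ -
    matToRat P.toBlocks₂₁ * (matToRat P.toBlocks₁₁)⁻¹ * matToRat P.toBlocks₁₂

/-- The linear polynomial system matrix
`[M_A, M_B; K_A, 0; -M_C, M_D; 0, K_D]` with state matrix `[M_A; K_A]`. -/
def linearization {F : Type*} [Field F] {α κ β δ ν ω : Type*}
    (MA : Matrix α ν F[X]) (KA : Matrix κ ν F[X]) (MB : Matrix α ω F[X])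
    (MC : Matrix β ν F[X]) (MD : Matrix β ω F[X]) (KD : Matrix δ ω F[X]) :
    Matrix ((α ⊕ κ) ⊕ (β ⊕ δ)) (ν ⊕ ω) F[X] :=
  Matrix.fromBlocks
    (Matrix.fromRows MA KA) (Matrix.fromRows MB 0)
    (Matrix.fromRows (-MC) 0) (Matrix.fromRows MD KD)

/-- The reversal `rev_d P (λ) = λ ^ d P (1 / λ)` of a polynomial matrix of degree at most `d`. -/
def matRev {F : Type*} [Field F] {μ ν : Type*} (d : ℕ) (P : Matrix μ ν F[X]) :
    Matrix μ ν F[X] :=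
  P.map (Polynomial.reflect d)

/-- The value `P (a)` of a polynomial matrix. -/
def matEval {F : Type*} [Field F] {μ ν : Type*} (a : F) (P : Matrix μ ν F[X]) :
    Matrix μ ν F :=
  P.map (Polynomial.eval a)

end

end RationalLinearization

open RationalLinearization

/-! Write `S` for the system matrix `[A, B; -C, D]`. The rows `K_A y = 0` and `K_D x = 0` force a
null vector `[y; x]` of the pencil to be `y = N_Aᵀ w`, `x = N_Dᵀ u` by duality, and the remaining
rows then say that `[w; u]` is a null vector of `S` (`linearization_mulVec_eq_zero_iff`). For a
system matrix with nonsingular state matrix, dropping the state part identifies its null space with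
that of its transfer function. Hence `N_Dᵀ` maps the null space of `R` onto that of `R̂`, and
`nullVectorLift` maps the latter onto that of the pencil, both injectively.

`IsMinimalBasis.of_map` carries minimal bases back along such a map, provided that it sends
polynomial null vectors to polynomial ones with a constant degree shift. For `N_Dᵀ` the shift is
`ρ_D`: a minimal basis with equal row degrees has a leading coefficient matrix of full rank. For
`nullVectorLift` the shift is `0`, by `exists_polynomial_lift`. Here `[A; C] w = [-B; D] u`; full
column rank at every finite point makes `w` polynomial, and full column rank at infinity gives `deg
w + ρ_A + 1 ≤ deg u + ρ_D + 1`, so `deg y ≤ deg w + ρ_A ≤ deg u + ρ_D = deg x`. -/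

open RationalLinearization

namespace RationalLinearization

/-! ### Passage from polynomials to rational functions. -/

section Casts

variable {F : Type*} [Field F] {μ ν κ : Type*}

theorem vecToRat_injective : Function.Injective (vecToRat : (ν → F[X]) → ν → RatFunc F) :=
  fun _ _ h => funext fun j => RatFunc.algebraMap_injective F (congrFun h j)

@[simp]
theorem vecToRat_zero : vecToRat (0 : ν → F[X]) = 0 := by
  ext j; simp [vecToRat]

theorem vecToRat_smul (q : F[X]) (v : ν → F[X]) :
    vecToRat (q • v) = algebraMap F[X] (RatFunc F) q • vecToRat v := by
  ext j; simp [vecToRat]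

theorem vecToRat_sum_smul {ι : Type*} [Fintype ι] (c : ι → F[X]) (b : ι → ν → F[X]) :
    vecToRat (∑ i, c i • b i) = ∑ i, algebraMap F[X] (RatFunc F) (c i) • vecToRat (b i) := by
  ext j; simp [vecToRat, Algebra.smul_def]

theorem vecToRat_elim (y : μ → F[X]) (x : ν → F[X]) :
    vecToRat (Sum.elim y x) = Sum.elim (vecToRat y) (vecToRat x) := by
  ext (j | j) <;> rfl

theorem vecToRat_mulVec [Fintype ν] (P : Matrix μ ν F[X]) (v : ν → F[X]) :
    vecToRat (P.mulVec v) = (matToRat P).mulVec (vecToRat v) := by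
  ext i; simp [vecToRat, matToRat, Matrix.mulVec, dotProduct]

theorem matToRat_mul [Fintype ν] (P : Matrix μ ν F[X]) (Q : Matrix ν κ F[X]) :
    matToRat (P * Q) = matToRat P * matToRat Q :=
  Matrix.map_mul

theorem matToRat_neg (P : Matrix μ ν F[X]) : matToRat (-P) = -matToRat P := by
  ext; simp [matToRat]

theorem matToRat_zero : matToRat (0 : Matrix μ ν F[X]) = 0 := by
  ext; simp [matToRat]

theorem matToRat_transpose (P : Matrix μ ν F[X]) :
    matToRat P.transpose = (matToRat P).transpose := rfl

theorem matToRat_fromRows (P : Matrix μ ν F[X]) (Q : Matrix κ ν F[X]) :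
    matToRat (Matrix.fromRows P Q) = Matrix.fromRows (matToRat P) (matToRat Q) := by
  ext (i | i) j <;> rfl

theorem det_matToRat [Fintype ν] [DecidableEq ν] (P : Matrix ν ν F[X]) :
    (matToRat P).det = algebraMap F[X] (RatFunc F) P.det :=
  ((algebraMap F[X] (RatFunc F)).map_det P).symm

theorem matEval_mulVec [Fintype ν] (a : F) (P : Matrix μ ν F[X]) (v : ν → F[X]) :
    (fun i => (P.mulVec v i).eval a) = (matEval a P).mulVec fun j => (v j).eval a := by
  ext i; simp [matEval, Matrix.mulVec, dotProduct, eval_finsetSum]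

theorem mem_rightNullSpace [Fintype ν] {R : Matrix μ ν (RatFunc F)} {x : ν → RatFunc F} :
    x ∈ rightNullSpace R ↔ R.mulVec x = 0 := Iff.rfl

end Casts

/-! ### Degrees of polynomial vectors and of matrix-vector products. -/

section Degree

variable {F : Type*} [Field F] {μ ν κ : Type*} [Fintype ν]

theorem natDegree_le_vecDegree (v : ν → F[X]) (j : ν) : (v j).natDegree ≤ vecDegree v :=
  Finset.le_sup (f := fun j => (v j).natDegree) (Finset.mem_univ j)

theorem vecDegree_le_iff {v : ν → F[X]} {d : ℕ} :
    vecDegree v ≤ d ↔ ∀ j, (v j).natDegree ≤ d := by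
  simp [vecDegree]

theorem vecDegree_elim [Fintype μ] (y : μ → F[X]) (x : ν → F[X]) :
    vecDegree (Sum.elim y x) = max (vecDegree y) (vecDegree x) := by
  refine le_antisymm (vecDegree_le_iff.2 ?_) (max_le (vecDegree_le_iff.2 fun j => ?_)
    (vecDegree_le_iff.2 fun j => ?_))
  · rintro (j | j)
    · exact le_max_of_le_left (natDegree_le_vecDegree y j)
    · exact le_max_of_le_right (natDegree_le_vecDegree x j)
  · exact natDegree_le_vecDegree (Sum.elim y x) (Sum.inl j)
  · exact natDegree_le_vecDegree (Sum.elim y x) (Sum.inr j)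

@[simp]
theorem vecDegree_zero : vecDegree (0 : ν → F[X]) = 0 := by
  simp [vecDegree]

theorem exists_natDegree_eq_vecDegree {v : ν → F[X]} (hv : v ≠ 0) :
    ∃ j, v j ≠ 0 ∧ (v j).natDegree = vecDegree v := by
  obtain ⟨j₀, hj₀⟩ := Function.ne_iff.1 hv
  obtain ⟨j, -, hj⟩ := Finset.exists_mem_eq_sup Finset.univ ⟨j₀, Finset.mem_univ _⟩
    fun j => (v j).natDegree
  -- The supremum may be attained at a zero entry, whose `natDegree` is `0`; then all entries are
  -- constants and any nonzero one serves.
  by_cases h : v j = 0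
  · refine ⟨j₀, hj₀, le_antisymm (natDegree_le_vecDegree v j₀) ?_⟩
    change vecDegree v = (v j).natDegree at hj
    simp [hj, h]
  · exact ⟨j, h, hj.symm⟩

theorem natDegree_mulVec_le {P : Matrix μ ν F[X]} {d : ℕ} (hP : ∀ i j, (P i j).natDegree ≤ d)
    (v : ν → F[X]) (i : μ) : (P.mulVec v i).natDegree ≤ d + vecDegree v :=
  natDegree_sum_le_of_forall_le _ _ fun j _ =>
    natDegree_mul_le_of_le (hP i j) (natDegree_le_vecDegree v j)

theorem natDegree_matrix_mul_le {P : Matrix μ ν F[X]} {Q : Matrix ν κ F[X]} {d e : ℕ}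
    (hP : ∀ i j, (P i j).natDegree ≤ d) (hQ : ∀ i j, (Q i j).natDegree ≤ e) (i : μ) (k : κ) :
    ((P * Q) i k).natDegree ≤ d + e :=
  natDegree_sum_le_of_forall_le _ _ fun j _ => natDegree_mul_le_of_le (hP i j) (hQ j k)

/-- The coefficient of `P v` in degree `d + deg v` is the degree-`d` coefficient matrix of `P`
applied to the leading coefficient vector of `v`, so no cancellation can kill it. -/
theorem le_vecDegree_mulVec [Fintype μ] {P : Matrix μ ν F[X]} {d : ℕ}
    (hP : ∀ i j, (P i j).natDegree ≤ d)
    (hlead : ∀ c : ν → F, (P.map fun p => p.coeff d).mulVec c = 0 → c = 0)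
    {v : ν → F[X]} (hv : v ≠ 0) : d + vecDegree v ≤ vecDegree (P.mulVec v) := by
  have hc : (fun j => (v j).coeff (vecDegree v)) ≠ 0 := by
    obtain ⟨j, hj, hdeg⟩ := exists_natDegree_eq_vecDegree hv
    intro h
    have := congrFun h j
    simp only [← hdeg, coeff_natDegree, Pi.zero_apply, leadingCoeff_eq_zero] at this
    exact hj this
  obtain ⟨i, hi⟩ := Function.ne_iff.1 fun h => hc (hlead _ h)
  have key : (P.mulVec v i).coeff (d + vecDegree v) =
      (P.map fun p => p.coeff d).mulVec (fun j => (v j).coeff (vecDegree v)) i := by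
    simp only [Matrix.mulVec, dotProduct, finsetSum_coeff, Matrix.map_apply]
    exact Finset.sum_congr rfl fun j _ =>
      coeff_mul_add_eq_of_natDegree_le (hP i j) (natDegree_le_vecDegree v j)
  refine le_trans (le_natDegree_of_ne_zero ?_) (natDegree_le_vecDegree _ i)
  rw [key]
  exact hi

theorem vecDegree_mulVec [Fintype μ] {P : Matrix μ ν F[X]} {d : ℕ}
    (hP : ∀ i j, (P i j).natDegree ≤ d)
    (hlead : ∀ c : ν → F, (P.map fun p => p.coeff d).mulVec c = 0 → c = 0)
    {v : ν → F[X]} (hv : v ≠ 0) : vecDegree (P.mulVec v) = d + vecDegree v :=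
  le_antisymm (vecDegree_le_iff.2 (natDegree_mulVec_le hP v)) (le_vecDegree_mulVec hP hlead hv)

end Degree

/-! ### Polynomiality of rational solutions under full column rank at every point. -/

section Integrality

variable {F : Type*} [Field F] [IsAlgClosed F] {μ ν : Type*} [Fintype ν]

/-- Peel off the roots of `q` one at a time: at a root `a`, `P(a) v(a) = 0` forces `v(a) = 0`, so `X
- a` divides `v` and cancels on both sides. -/
theorem exists_smul_eq_of_mulVec_eq_smul {P : Matrix μ ν F[X]}
    (hP : ∀ (a : F) (c : ν → F), (matEval a P).mulVec c = 0 → c = 0)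
    (d : ℕ) {q : F[X]} (hq : q ≠ 0) (hd : q.natDegree = d) {v : ν → F[X]} {g : μ → F[X]}
    (h : P.mulVec v = q • g) : ∃ w, v = q • w := by
  induction d generalizing q v with
  | zero =>
    obtain ⟨c, rfl⟩ := natDegree_eq_zero.1 hd
    have hc : c ≠ 0 := by rintro rfl; simp at hq
    refine ⟨C c⁻¹ • v, ?_⟩
    rw [smul_smul, ← C_mul, mul_inv_cancel₀ hc, C_1, one_smul]
  | succ d ih =>
    obtain ⟨a, ha⟩ := IsAlgClosed.exists_root q (by
      rw [degree_eq_natDegree hq, hd]; exact_mod_cast d.succ_ne_zero)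
    obtain ⟨q', rfl⟩ := dvd_iff_isRoot.2 ha
    have hq' : q' ≠ 0 := right_ne_zero_of_mul hq
    have hv := hP a (fun j => (v j).eval a) (by
      rw [← matEval_mulVec, h]
      ext i; simp)
    have hdvd : ∀ j, ∃ r, v j = (X - C a) * r := fun j =>
      dvd_iff_isRoot.2 (congrFun hv j)
    choose v' hv' using hdvd
    obtain rfl : v = (X - C a) • v' := funext hv'
    have hd' : q'.natDegree = d := by
      rw [natDegree_mul (X_sub_C_ne_zero a) hq', natDegree_X_sub_C] at hd
      omega
    obtain ⟨w, rfl⟩ := ih hq' hd' (v := v') (by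
      refine smul_right_injective _ (X_sub_C_ne_zero a) ?_
      simpa [Matrix.mulVec_smul, smul_smul] using h)
    exact ⟨w, by rw [smul_smul]⟩

/-- If `P (a)` has full column rank for all `a`, then a rational vector `w` for which `P w` is
polynomial is itself polynomial. -/
theorem exists_vecToRat_eq_of_mulVec {P : Matrix μ ν F[X]}
    (hP : ∀ (a : F) (c : ν → F), (matEval a P).mulVec c = 0 → c = 0)
    {w : ν → RatFunc F} {g : μ → F[X]} (h : (matToRat P).mulVec w = vecToRat g) :
    ∃ v, vecToRat v = w := by
  obtain ⟨⟨q, hq⟩, hint⟩ := IsLocalization.exist_integer_multiples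
    (nonZeroDivisors F[X]) Finset.univ w
  choose v hv using fun j => hint j (Finset.mem_univ j)
  have hq0 : q ≠ 0 := nonZeroDivisors.ne_zero hq
  have hqR : algebraMap F[X] (RatFunc F) q ≠ 0 := by
    simpa using hq0
  have hvw : vecToRat v = algebraMap F[X] (RatFunc F) q • w := by
    ext j
    simpa [vecToRat, Algebra.smul_def] using hv j
  obtain ⟨u, rfl⟩ := exists_smul_eq_of_mulVec_eq_smul hP _ hq0 rfl (v := v) (g := g) (by
    apply vecToRat_injective
    rw [vecToRat_mulVec, hvw, Matrix.mulVec_smul, h, vecToRat_smul])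
  rw [vecToRat_smul] at hvw
  exact ⟨u, smul_right_injective _ hqR hvw⟩

end Integrality

/-! ### Exchange in minimal bases, its rank consequences, and transport of minimal bases. -/

section MinimalBasis

variable {F : Type*} [Field F] {ι μ ν : Type*} [Fintype ι]

theorem IsPolynomialBasis.sum_smul_ne_zero {V : Submodule (RatFunc F) (ν → RatFunc F)}
    {b : ι → ν → F[X]} (hb : IsPolynomialBasis V b) {c : ι → F[X]} {i₀ : ι} (hc : c i₀ ≠ 0) :
    ∑ i, c i • b i ≠ 0 := by
  intro h
  have := Fintype.linearIndependent_iff.1 hb.1 _ (by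
    rw [← vecToRat_sum_smul, h, vecToRat_zero]) i₀
  exact hc (by simpa using this)

variable [Fintype ν]

theorem IsPolynomialBasis.update [DecidableEq ι] {V : Submodule (RatFunc F) (ν → RatFunc F)}
    {b : ι → ν → F[X]} (hb : IsPolynomialBasis V b) {c : ι → F[X]} {i₀ : ι} (hc : c i₀ ≠ 0)
    {q : F[X]} (hq : q ≠ 0) {v : ν → F[X]} (h : ∑ i, c i • b i = q • v) :
    IsPolynomialBasis V (Function.update b i₀ v) := by
  have hqR : algebraMap F[X] (RatFunc F) q ≠ 0 := by simpa using hq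
  have hrat := congrArg vecToRat h
  rw [vecToRat_sum_smul, vecToRat_smul] at hrat
  have hupd : (fun i => vecToRat (Function.update b i₀ v i)) =
      Function.update (fun i => vecToRat (b i)) i₀ (vecToRat v) := by
    ext i : 1
    by_cases hi : i = i₀
    · subst hi; simp
    · simp [hi]
  have hmem : ∀ i, vecToRat (b i) ∈ V := fun i => by
    rw [← hb.2]; exact Submodule.subset_span ⟨i, rfl⟩
  have hv : vecToRat v ∈ V := by
    have : algebraMap F[X] (RatFunc F) q • vecToRat v ∈ V := by
      rw [← hrat]
      exact Submodule.sum_mem _ fun i _ => Submodule.smul_mem _ _ (hmem i)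
    exact (Submodule.smul_mem_iff _ hqR).1 this
  have hli : LinearIndependent (RatFunc F)
      (fun i => vecToRat (Function.update b i₀ v i)) := by
    rw [hupd]
    refine hb.1.update i₀ _ ⟨_, mem_nonZeroDivisors_of_ne_zero hqR,
      Finsupp.equivFunOnFinite.symm fun i => algebraMap F[X] (RatFunc F) (c i),
      mem_nonZeroDivisors_of_ne_zero (by simpa using hc), ?_⟩
    rw [← hrat, Finsupp.linearCombination_apply, Finsupp.sum_fintype _ _ (by simp)]
    rfl
  refine ⟨hli, Submodule.eq_of_le_of_finrank_le (Submodule.span_le.2 ?_) ?_⟩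
  · rintro _ ⟨i, rfl⟩
    by_cases hi : i = i₀
    · subst hi; simpa using hv
    · simpa [hi] using hmem i
  · rw [finrank_span_eq_card hli, ← hb.2, finrank_span_eq_card hb.1]

/-- Exchange principle: `v` may replace `b i₀` in the basis, so minimality of the degree sum forbids
`v` to have smaller degree. The factor `q` allows `v` to be a combination divided by a polynomial.
-/
theorem IsMinimalBasis.vecDegree_le {V : Submodule (RatFunc F) (ν → RatFunc F)}
    {b : ι → ν → F[X]} (hb : IsMinimalBasis V b) {c : ι → F[X]} {i₀ : ι} (hc : c i₀ ≠ 0)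
    {q : F[X]} (hq : q ≠ 0) {v : ν → F[X]} (h : ∑ i, c i • b i = q • v) :
    vecDegree (b i₀) ≤ vecDegree v := by
  classical
  have := hb.2 _ (hb.1.update hc hq h)
  rw [← Finset.add_sum_erase _ _ (Finset.mem_univ i₀),
    ← Finset.add_sum_erase _ (fun i => vecDegree (Function.update b i₀ v i))
      (Finset.mem_univ i₀), Function.update_self] at this
  have hrest : ∑ i ∈ Finset.univ.erase i₀, vecDegree (Function.update b i₀ v i) =
      ∑ i ∈ Finset.univ.erase i₀, vecDegree (b i) :=
    Finset.sum_congr rfl fun i hi => by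
      rw [Function.update_of_ne (Finset.ne_of_mem_erase hi)]
  omega

variable [Fintype μ]

theorem natDegree_sum_C_smul_le {b : ι → ν → F[X]} {ρ : ℕ} (hρ : ∀ i, vecDegree (b i) = ρ)
    (c : ι → F) (j : ν) : ((∑ i, C (c i) • b i) j).natDegree ≤ ρ := by
  rw [Finset.sum_apply]
  refine natDegree_sum_le_of_forall_le _ _ fun i _ => ?_
  rw [Pi.smul_apply, smul_eq_mul]
  exact (natDegree_C_mul_le _ _).trans ((natDegree_le_vecDegree _ j).trans (hρ i).le)

/-- A constant combination of the rows that vanishes at `a` is divisible by `X - a`. As all rows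
have degree `ρ`, the quotient has degree below `ρ`, against the exchange principle. -/
theorem IsRowMinimalBasis.eq_zero_of_matEval_mulVec {N : Matrix μ ν F[X]} {ρ : ℕ}
    (hN : IsRowMinimalBasis N) (hρ : ∀ i, vecDegree (N i) = ρ) (a : F) (c : μ → F)
    (h : (matEval a N.transpose).mulVec c = 0) : c = 0 := by
  by_contra hc
  obtain ⟨i₀, hi₀⟩ := Function.ne_iff.1 hc
  have hCi₀ : C (c i₀) ≠ 0 := by simpa using hi₀
  have hdvd : ∀ j, ∃ r, (∑ i, C (c i) • N i) j = (X - C a) * r := fun j => by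
    refine dvd_iff_isRoot.2 ?_
    have := congrFun h j
    simpa [matEval, Matrix.mulVec, dotProduct, eval_finsetSum, mul_comm] using this
  choose v hv using hdvd
  have hv' : ∑ i, C (c i) • N i = (X - C a) • v := funext hv
  have hne : v ≠ 0 := by
    rintro rfl
    exact hN.1.sum_smul_ne_zero (c := fun i => C (c i)) hCi₀ (by rw [hv', smul_zero])
  have hle := hN.vecDegree_le (c := fun i => C (c i)) hCi₀ (X_sub_C_ne_zero a) hv'
  obtain ⟨j, hj, hdeg⟩ := exists_natDegree_eq_vecDegree hne
  have h1 := natDegree_sum_C_smul_le hρ c j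
  rw [hv j, natDegree_mul (X_sub_C_ne_zero a) hj, natDegree_X_sub_C] at h1
  rw [hρ i₀] at hle
  omega

/-- If the coefficients of degree `ρ` cancelled in a nontrivial constant combination of the rows,
that combination would itself be an exchange vector of degree below `ρ`. -/
theorem IsRowMinimalBasis.eq_zero_of_coeff_mulVec {N : Matrix μ ν F[X]} {ρ : ℕ}
    (hN : IsRowMinimalBasis N) (hρ : ∀ i, vecDegree (N i) = ρ) (c : μ → F)
    (h : (N.transpose.map fun p => p.coeff ρ).mulVec c = 0) : c = 0 := by
  by_contra hc
  obtain ⟨i₀, hi₀⟩ := Function.ne_iff.1 hc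
  have hCi₀ : C (c i₀) ≠ 0 := by simpa using hi₀
  have hne := hN.1.sum_smul_ne_zero (c := fun i => C (c i)) hCi₀
  have hle := hN.vecDegree_le (c := fun i => C (c i)) hCi₀ one_ne_zero (one_smul _ _).symm
  rw [hρ i₀] at hle
  obtain ⟨j, hj, hdeg⟩ := exists_natDegree_eq_vecDegree hne
  have hd : ((∑ i, C (c i) • N i) j).natDegree = ρ :=
    le_antisymm (natDegree_sum_C_smul_le hρ c j) (hdeg ▸ hle)
  apply hj
  rw [← leadingCoeff_eq_zero, leadingCoeff, hd]
  have := congrFun h j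
  simpa [Matrix.mulVec, dotProduct, finsetSum_coeff, mul_comm] using this

/-- Minimal bases are carried back along a linear map that identifies two rational subspaces and
their polynomial vectors, and shifts all degrees by the same amount. -/
theorem IsMinimalBasis.of_map {V : Submodule (RatFunc F) (ν → RatFunc F)}
    {V' : Submodule (RatFunc F) (μ → RatFunc F)}
    (f : (μ → RatFunc F) →ₗ[RatFunc F] (ν → RatFunc F)) (hdisj : Disjoint V' (LinearMap.ker f))
    (hmap : V'.map f = V) (ρ : ℕ)
    (hdeg : ∀ g' : μ → F[X], vecToRat g' ∈ V' → g' ≠ 0 →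
      ∃ g, vecToRat g = f (vecToRat g') ∧ vecDegree g = vecDegree g' + ρ)
    {b : ι → ν → F[X]} {b' : ι → μ → F[X]} (hb : IsMinimalBasis V b)
    (hb' : ∀ i, vecToRat (b' i) ∈ V') (hbb' : ∀ i, f (vecToRat (b' i)) = vecToRat (b i)) :
    IsMinimalBasis V' b' ∧ ∀ i, vecDegree (b i) = vecDegree (b' i) + ρ := by
  have hli : LinearIndependent (RatFunc F) fun i => vecToRat (b' i) := by
    refine LinearIndependent.of_comp f ?_
    convert hb.1.1 using 1
    exact funext hbb'
  have hspan_le : Submodule.span (RatFunc F) (Set.range fun i => vecToRat (b' i)) ≤ V' :=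
    Submodule.span_le.2 (by rintro _ ⟨i, rfl⟩; exact hb' i)
  have hpoly : IsPolynomialBasis V' b' := by
    refine ⟨hli, le_antisymm hspan_le fun x hx => ?_⟩
    have hfx : f x ∈ (Submodule.span (RatFunc F) (Set.range fun i => vecToRat (b' i))).map f := by
      rw [Submodule.map_span, ← Set.range_comp]
      have : (f ∘ fun i => vecToRat (b' i)) = fun i => vecToRat (b i) := funext hbb'
      rw [this, hb.1.2, ← hmap]
      exact Submodule.mem_map_of_mem hx
    obtain ⟨x', hx', hxx'⟩ := hfx
    have : x - x' = 0 := Submodule.disjoint_def.1 hdisj _ (V'.sub_mem hx (hspan_le hx'))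
      (by simp [hxx'])
    rwa [sub_eq_zero.1 this]
  have hne : ∀ b'' : ι → μ → F[X], IsPolynomialBasis V' b'' → ∀ i, b'' i ≠ 0 :=
    fun b'' h i h0 => h.1.ne_zero i (by simp [h0])
  have hdegb : ∀ i, vecDegree (b i) = vecDegree (b' i) + ρ := fun i => by
    obtain ⟨g, hg, hgd⟩ := hdeg _ (hb' i) (hne _ hpoly i)
    rw [hbb' i] at hg
    rwa [vecToRat_injective hg] at hgd
  refine ⟨⟨hpoly, fun b'' hb'' => ?_⟩, hdegb⟩
  have hmem : ∀ i, vecToRat (b'' i) ∈ V' := fun i => by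
    rw [← hb''.2]; exact Submodule.subset_span ⟨i, rfl⟩
  -- A competing basis of `V'` is pushed forward to a competing basis of `V`; both degree sums grow
  -- by the same multiple of `ρ`.
  choose g hg hgd using fun i => hdeg _ (hmem i) (hne _ hb'' i)
  have hcomp : (fun i => vecToRat (g i)) = f ∘ fun i => vecToRat (b'' i) := funext hg
  have := hb.2 g ⟨by
      rw [hcomp]
      exact hb''.1.map (by rw [hb''.2]; exact hdisj), by
      rw [hcomp, Set.range_comp, ← Submodule.map_span, hb''.2, hmap]⟩
  simp only [hgd, hdegb, Finset.sum_add_distrib] at this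
  omega

end MinimalBasis

/-! ### Dual minimal bases and null spaces. -/

section Dual

variable {F : Type*} [Field F] {κ μ ν : Type*} [Fintype κ] [Fintype μ] [Fintype ν]

/-- `K Nᵀ = 0` gives one inclusion, and the dimensions agree by rank-nullity because both matrices
have full row rank and their row counts add up to the number of columns. -/
theorem AreDualMinimalBases.rightNullSpace_eq {K : Matrix κ ν F[X]} {N : Matrix μ ν F[X]}
    (h : AreDualMinimalBases K N) :
    rightNullSpace (matToRat K) = LinearMap.range (matToRat N.transpose).mulVecLin := by
  have hK : (matToRat K).rank = Fintype.card κ :=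
    LinearIndependent.rank_matrix h.left_minimal.1.1
  have hN : (matToRat N.transpose).rank = Fintype.card μ := by
    rw [matToRat_transpose, Matrix.rank_transpose]
    exact LinearIndependent.rank_matrix h.right_minimal.1.1
  symm
  refine Submodule.eq_of_le_of_finrank_le ?_ ?_
  · rintro _ ⟨w, rfl⟩
    rw [mem_rightNullSpace, Matrix.mulVecLin_apply, Matrix.mulVec_mulVec, ← matToRat_mul,
      h.mul_transpose, matToRat_zero, Matrix.zero_mulVec]
  · have := LinearMap.finrank_range_add_finrank_ker (matToRat K).mulVecLin
    rw [Module.finrank_fintype_fun_eq_card] at this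
    have hc := h.card_add
    unfold Matrix.rank at hK hN
    unfold rightNullSpace
    omega

theorem AreDualMinimalBases.mulVec_eq_zero_iff {K : Matrix κ ν F[X]} {N : Matrix μ ν F[X]}
    (h : AreDualMinimalBases K N) (x : ν → RatFunc F) :
    (matToRat K).mulVec x = 0 ↔ ∃ w, (matToRat N.transpose).mulVec w = x := by
  rw [← mem_rightNullSpace, h.rightNullSpace_eq]; rfl

theorem IsRowMinimalBasis.eq_zero_of_mulVec {N : Matrix μ ν F[X]}
    (h : IsRowMinimalBasis N) {w : μ → RatFunc F}
    (hw : (matToRat N.transpose).mulVec w = 0) : w = 0 := by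
  refine funext (Fintype.linearIndependent_iff.1 h.1.1 w ?_)
  rw [← hw]
  ext j
  simp [Matrix.mulVec, dotProduct, matToRat, vecToRat, mul_comm]

end Dual


/-! ### Block elimination of the state variables. -/

section Schur

variable {F : Type*} [Field F] {α α' β γ : Type*}

theorem matToRat_fromBlocks (A : Matrix α α' F[X]) (B : Matrix α γ F[X])
    (C : Matrix β α' F[X]) (D : Matrix β γ F[X]) :
    matToRat (Matrix.fromBlocks A B C D) =
      Matrix.fromBlocks (matToRat A) (matToRat B) (matToRat C) (matToRat D) :=
  Matrix.fromBlocks_map _ _ _ _ _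

variable [Fintype α'] [Fintype γ]

theorem matToRat_mulVec_elim_eq_zero_iff (A : Matrix α α' F[X]) (B : Matrix α γ F[X])
    (C : Matrix β α' F[X]) (D : Matrix β γ F[X]) (y : α' → RatFunc F) (x : γ → RatFunc F) :
    (matToRat (Matrix.fromBlocks A B C D)).mulVec (Sum.elim y x) = 0 ↔
      (matToRat A).mulVec y + (matToRat B).mulVec x = 0 ∧
        (matToRat C).mulVec y + (matToRat D).mulVec x = 0 := by
  rw [matToRat_fromBlocks, Matrix.fromBlocks_mulVec, ← Sum.elim_zero_zero, Sum.elim_eq_iff]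
  simp

variable [Fintype α] [DecidableEq α]

theorem mulVec_elim_eq_zero_iff_transferFunction (P : Matrix (α ⊕ β) (α ⊕ γ) F[X])
    (hP : P.toBlocks₁₁.det ≠ 0) (y : α → RatFunc F) (x : γ → RatFunc F) :
    (matToRat P).mulVec (Sum.elim y x) = 0 ↔
      y = (-((matToRat P.toBlocks₁₁)⁻¹ * matToRat P.toBlocks₁₂)).mulVec x ∧
        (transferFunction P).mulVec x = 0 := by
  have hu : IsUnit (matToRat P.toBlocks₁₁).det := by
    rw [det_matToRat, isUnit_iff_ne_zero]
    simpa using hP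
  conv_lhs => rw [← P.fromBlocks_toBlocks]
  rw [matToRat_mulVec_elim_eq_zero_iff]
  have h1 : (matToRat P.toBlocks₁₁).mulVec y + (matToRat P.toBlocks₁₂).mulVec x = 0 ↔
      y = (-((matToRat P.toBlocks₁₁)⁻¹ * matToRat P.toBlocks₁₂)).mulVec x := by
    rw [Matrix.neg_mulVec, ← Matrix.mulVec_mulVec, eq_neg_iff_add_eq_zero]
    constructor <;> intro h
    · have := congrArg (matToRat P.toBlocks₁₁)⁻¹.mulVec h
      rwa [Matrix.mulVec_add, Matrix.mulVec_mulVec, Matrix.nonsing_inv_mul _ hu,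
        Matrix.one_mulVec, Matrix.mulVec_zero] at this
    · have := congrArg (matToRat P.toBlocks₁₁).mulVec h
      rwa [Matrix.mulVec_add, Matrix.mulVec_mulVec ((matToRat P.toBlocks₁₂).mulVec x),
        Matrix.mul_nonsing_inv _ hu, Matrix.one_mulVec, Matrix.mulVec_zero] at this
  rw [h1]
  refine and_congr_right fun hy => ?_
  rw [hy, transferFunction, Matrix.sub_mulVec, Matrix.mulVec_mulVec, Matrix.mul_neg,
    Matrix.neg_mulVec, neg_add_eq_sub, Matrix.mul_assoc]

end Schur

/-! ### Null vectors of the pencil, and their polynomial lifts. -/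

section Linearization

variable {F : Type*} [Field F] {α κ β γ δ : Type*} [Fintype α] [Fintype κ] [Fintype γ] [Fintype δ]

theorem linearization_mulVec_eq_zero_iff {MA : Matrix α (α ⊕ κ) F[X]} {KA : Matrix κ (α ⊕ κ) F[X]}
    {NA : Matrix α (α ⊕ κ) F[X]} {MD : Matrix β (γ ⊕ δ) F[X]} {KD : Matrix δ (γ ⊕ δ) F[X]}
    {ND : Matrix γ (γ ⊕ δ) F[X]} (hA : AreDualMinimalBases KA NA) (hD : AreDualMinimalBases KD ND)
    (MB : Matrix α (γ ⊕ δ) F[X]) (MC : Matrix β (α ⊕ κ) F[X])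
    (y : α ⊕ κ → RatFunc F) (x : γ ⊕ δ → RatFunc F) :
    (matToRat (linearization MA KA MB MC MD KD)).mulVec (Sum.elim y x) = 0 ↔
      ∃ w u, (matToRat NA.transpose).mulVec w = y ∧ (matToRat ND.transpose).mulVec u = x ∧
        (matToRat (Matrix.fromBlocks (MA * NA.transpose) (MB * ND.transpose)
          (-(MC * NA.transpose)) (MD * ND.transpose))).mulVec (Sum.elim w u) = 0 := by
  have key : (matToRat (linearization MA KA MB MC MD KD)).mulVec (Sum.elim y x) = 0 ↔
      ((matToRat MA).mulVec y + (matToRat MB).mulVec x = 0 ∧ (matToRat KA).mulVec y = 0) ∧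
      (-(matToRat MC).mulVec y + (matToRat MD).mulVec x = 0 ∧ (matToRat KD).mulVec x = 0) := by
    rw [linearization, matToRat_mulVec_elim_eq_zero_iff]
    simp only [matToRat_fromRows, Matrix.fromRows_mulVec, matToRat_zero, matToRat_neg,
      Matrix.neg_mulVec, Matrix.zero_mulVec, ← Sum.elim_add_add, ← Sum.elim_zero_zero,
      Sum.elim_eq_iff, add_zero, zero_add]
  rw [key, hA.mulVec_eq_zero_iff, hD.mulVec_eq_zero_iff]
  simp only [matToRat_mulVec_elim_eq_zero_iff, matToRat_neg, matToRat_mul, Matrix.neg_mulVec,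
    ← Matrix.mulVec_mulVec]
  constructor
  · rintro ⟨⟨h1, w, rfl⟩, h2, u, rfl⟩
    exact ⟨w, u, rfl, rfl, h1, h2⟩
  · rintro ⟨w, u, rfl, rfl, h1, h2⟩
    exact ⟨⟨h1, w, rfl⟩, h2, u, rfl⟩

/-- A null vector is `N_Aᵀ w` by duality, and then `M_A N_Aᵀ w = 0` forces `w = 0`. This makes the
transfer function of the pencil meaningful. -/
theorem det_fromRows_ne_zero [DecidableEq α] [DecidableEq κ] {MA : Matrix α (α ⊕ κ) F[X]}
    {KA : Matrix κ (α ⊕ κ) F[X]} {NA : Matrix α (α ⊕ κ) F[X]} (hd : AreDualMinimalBases KA NA)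
    (hA : (MA * NA.transpose).det ≠ 0) : (Matrix.fromRows MA KA).det ≠ 0 := by
  intro h
  have h' : (matToRat (Matrix.fromRows MA KA)).det = 0 := by rw [det_matToRat, h, map_zero]
  obtain ⟨y, hy, h0⟩ := Matrix.exists_mulVec_eq_zero_iff.2 h'
  rw [matToRat_fromRows, Matrix.fromRows_mulVec, ← Sum.elim_zero_zero, Sum.elim_eq_iff,
    hd.mulVec_eq_zero_iff] at h0
  obtain ⟨h1, w, rfl⟩ := h0
  rw [Matrix.mulVec_mulVec, ← matToRat_mul] at h1
  have hw : w = 0 := by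
    by_contra hw
    have := Matrix.exists_mulVec_eq_zero_iff.1 ⟨w, hw, h1⟩
    rw [det_matToRat] at this
    exact hA (by simpa using this)
  exact hy (by rw [hw, Matrix.mulVec_zero])

theorem natDegree_le_of_vecDegree_eq {μ ν : Type*} [Fintype ν] {N : Matrix μ ν F[X]} {ρ : ℕ}
    (h : ∀ i, vecDegree (N i) = ρ) (j : ν) (i : μ) : (N.transpose j i).natDegree ≤ ρ :=
  (natDegree_le_vecDegree (N i) j).trans (h i).le

theorem eq_zero_of_rank_eq_card {μ ν : Type*} [Finite μ] [Fintype ν] {P : Matrix μ ν F}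
    (h : P.rank = Fintype.card ν) {c : ν → F} (hc : P.mulVec c = 0) : c = 0 := by
  have hinj : LinearMap.ker P.mulVecLin = ⊥ := by
    have := LinearMap.finrank_range_add_finrank_ker P.mulVecLin
    rw [Module.finrank_fintype_fun_eq_card] at this
    unfold Matrix.rank at h
    exact Submodule.finrank_eq_zero.1 (by omega)
  exact LinearMap.ker_eq_bot'.1 hinj c hc

/-- A polynomial null vector `x` of the transfer function of the linearization lifts to a
polynomial null vector `[y; x]` of the linearization of the same degree, and comes from a
polynomial null vector `u` of the original transfer function. -/
theorem exists_polynomial_lift [IsAlgClosed F] [DecidableEq α] [DecidableEq κ] [Fintype β]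
    {ρA ρD : ℕ} {A : Matrix α α F[X]} {B : Matrix α γ F[X]} {C : Matrix β α F[X]}
    {D : Matrix β γ F[X]} {MA : Matrix α (α ⊕ κ) F[X]} {KA : Matrix κ (α ⊕ κ) F[X]}
    {NA : Matrix α (α ⊕ κ) F[X]} {MD : Matrix β (γ ⊕ δ) F[X]} {KD : Matrix δ (γ ⊕ δ) F[X]}
    {ND : Matrix γ (γ ⊕ δ) F[X]}
    (hLA : IsStrongBlockMinimalBasisPencil MA KA NA ρA A)
    (hLD : IsStrongBlockMinimalBasisPencil MD KD ND ρD D)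
    {MB : Matrix α (γ ⊕ δ) F[X]} {MC : Matrix β (α ⊕ κ) F[X]}
    (hMB : IsLinearMatrix MB) (hMC : IsLinearMatrix MC)
    (hC : MC * NA.transpose = C) (hB : MB * ND.transpose = B)
    (hfinite : ∀ a : F,
      (Matrix.fromRows (matEval a A) (matEval a C)).rank = Fintype.card α)
    (hinfinite : (Matrix.fromRows (matEval 0 (matRev (ρA + 1) A))
      (matEval 0 (matRev (ρA + 1) C))).rank = Fintype.card α)
    {y' : α ⊕ κ → RatFunc F} {x : γ ⊕ δ → F[X]}
    (hx : (matToRat (linearization MA KA MB MC MD KD)).mulVec (Sum.elim y' (vecToRat x)) = 0) :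
    ∃ (y : α ⊕ κ → F[X]) (w : α → F[X]) (u : γ → F[X]),
      vecToRat y = y' ∧ ND.transpose.mulVec u = x ∧
      (matToRat (Matrix.fromBlocks A B (-C) D)).mulVec
        (Sum.elim (vecToRat w) (vecToRat u)) = 0 ∧
      vecDegree y ≤ vecDegree x := by
  rw [linearization_mulVec_eq_zero_iff hLA.dual hLD.dual, hLA.associated, hLD.associated,
    hC, hB] at hx
  obtain ⟨w', u', rfl, hu', h⟩ := hx
  obtain ⟨u, rfl⟩ := exists_vecToRat_eq_of_mulVec
    (fun a c => hLD.dual.right_minimal.eq_zero_of_matEval_mulVec hLD.rowDegree_dual a c) hu'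
  have hu : ND.transpose.mulVec u = x := vecToRat_injective (by rw [vecToRat_mulVec, hu'])
  have hS := (matToRat_mulVec_elim_eq_zero_iff _ _ _ _ _ _).1 h
  -- The equations of the system matrix are rearranged so that `w'` meets only `[A; C]`, the matrix
  -- whose rank is controlled at finite points and at infinity.
  have hAC : (matToRat (Matrix.fromRows A C)).mulVec w' =
      vecToRat ((Matrix.fromRows (-B) D).mulVec u) := by
    rw [vecToRat_mulVec, matToRat_fromRows, matToRat_fromRows, Matrix.fromRows_mulVec,
      Matrix.fromRows_mulVec, Sum.elim_eq_iff, matToRat_neg, Matrix.neg_mulVec]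
    refine ⟨eq_neg_of_add_eq_zero_left hS.1, ?_⟩
    have := hS.2
    rw [matToRat_neg, Matrix.neg_mulVec, neg_add_eq_zero] at this
    exact this
  obtain ⟨w, rfl⟩ := exists_vecToRat_eq_of_mulVec (fun a c hc => by
    refine eq_zero_of_rank_eq_card (hfinite a) ?_
    rw [← hc]
    congr 1
    ext (i | i) j <;> rfl) hAC
  refine ⟨NA.transpose.mulVec w, w, u, vecToRat_mulVec _ _, hu, h, ?_⟩
  rcases eq_or_ne w 0 with rfl | hw
  · simp
  have hAC' : (Matrix.fromRows A C).mulVec w = (Matrix.fromRows (-B) D).mulVec u :=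
    vecToRat_injective (by rw [vecToRat_mulVec, hAC])
  have hNA := natDegree_le_of_vecDegree_eq hLA.rowDegree_dual
  have hND := natDegree_le_of_vecDegree_eq hLD.rowDegree_dual
  have hdegAC : ∀ i j, (Matrix.fromRows A C i j).natDegree ≤ ρA + 1 := by
    rw [add_comm]
    rintro (i | i) j
    · rw [← hLA.associated]
      exact natDegree_matrix_mul_le hLA.linear_top hNA i j
    · rw [← hC]
      exact natDegree_matrix_mul_le hMC hNA i j
  have hdegBD : ∀ i j, (Matrix.fromRows (-B) D i j).natDegree ≤ ρD + 1 := by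
    rw [add_comm]
    rintro (i | i) j
    · rw [← hB]
      simpa using natDegree_matrix_mul_le hMB hND i j
    · rw [← hLD.associated]
      exact natDegree_matrix_mul_le hLD.linear_top hND i j
  -- The value at `0` of the reversal is the coefficient matrix of degree `ρA + 1`, so the rank
  -- condition at infinity is exactly the leading coefficient condition.
  have h1 := le_vecDegree_mulVec hdegAC (fun c hc => by
    refine eq_zero_of_rank_eq_card hinfinite ?_
    rw [← hc]
    congr 1
    ext (i | i) j <;> simp [matEval, matRev, ← coeff_zero_eq_eval_zero, coeff_reflect]) hw
  -- If `u = 0`, the right side is the zero vector, of degree `0` by convention, whereas the bound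
  -- just obtained is at least `ρA + 1`.
  have hu0 : u ≠ 0 := by
    rintro rfl
    rw [hAC', Matrix.mulVec_zero, vecDegree_zero] at h1
    omega
  rw [hAC'] at h1
  have h2 := vecDegree_le_iff.2 (natDegree_mulVec_le hdegBD u)
  have h3 := vecDegree_le_iff.2 (natDegree_mulVec_le hNA w)
  have h4 := vecDegree_mulVec hND
    (hLD.dual.right_minimal.eq_zero_of_coeff_mulVec hLD.rowDegree_dual) hu0
  rw [hu] at h4
  omega

end Linearization


/-! ### The null space of a system matrix as an image of that of its transfer function. -/

section NullSpaces

variable {F : Type*} [Field F] {α β γ : Type*} [Fintype α] [DecidableEq α] [Fintype γ]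
  [DecidableEq γ]

/-- The matrix `[-A⁻¹ B; I]` sending a null vector of the transfer function of `[A, B; -C, D]` to
a null vector of the system matrix. -/
noncomputable def nullVectorLift (P : Matrix (α ⊕ β) (α ⊕ γ) F[X]) :
    Matrix (α ⊕ γ) γ (RatFunc F) :=
  Matrix.fromRows (-((matToRat P.toBlocks₁₁)⁻¹ * matToRat P.toBlocks₁₂)) 1

theorem nullVectorLift_mulVec (P : Matrix (α ⊕ β) (α ⊕ γ) F[X]) (x : γ → RatFunc F) :
    (nullVectorLift P).mulVec x =
      Sum.elim ((-((matToRat P.toBlocks₁₁)⁻¹ * matToRat P.toBlocks₁₂)).mulVec x) x := by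
  rw [nullVectorLift, Matrix.fromRows_mulVec, Matrix.one_mulVec]

theorem matToRat_mulVec_elim_eq_zero_iff_nullVectorLift {P : Matrix (α ⊕ β) (α ⊕ γ) F[X]}
    (hP : P.toBlocks₁₁.det ≠ 0) (y : α → RatFunc F) (x : γ → RatFunc F) :
    (matToRat P).mulVec (Sum.elim y x) = 0 ↔
      (nullVectorLift P).mulVec x = Sum.elim y x ∧ (transferFunction P).mulVec x = 0 := by
  rw [mulVec_elim_eq_zero_iff_transferFunction P hP, nullVectorLift_mulVec, Sum.elim_eq_iff]
  simp [eq_comm]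

theorem ker_nullVectorLift (P : Matrix (α ⊕ β) (α ⊕ γ) F[X]) :
    LinearMap.ker (nullVectorLift P).mulVecLin = ⊥ := by
  refine LinearMap.ker_eq_bot'.2 fun x hx => ?_
  rw [Matrix.mulVecLin_apply, nullVectorLift_mulVec, ← Sum.elim_zero_zero, Sum.elim_eq_iff] at hx
  exact hx.2

theorem map_nullVectorLift {P : Matrix (α ⊕ β) (α ⊕ γ) F[X]} (hP : P.toBlocks₁₁.det ≠ 0) :
    (rightNullSpace (transferFunction P)).map (nullVectorLift P).mulVecLin =
      rightNullSpace (matToRat P) := by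
  ext z
  rw [← Sum.elim_comp_inl_inr z, mem_rightNullSpace,
    matToRat_mulVec_elim_eq_zero_iff_nullVectorLift hP]
  constructor
  · rintro ⟨x, hx, hxz⟩
    rw [Matrix.mulVecLin_apply] at hxz
    obtain rfl : x = z ∘ Sum.inr := by
      rw [nullVectorLift_mulVec, Sum.elim_eq_iff] at hxz
      exact hxz.2
    exact ⟨hxz, hx⟩
  · rintro ⟨h, hx⟩
    exact ⟨_, hx, h⟩

end NullSpaces

end RationalLinearization

/-! ### Minimal bases and minimal indices recovered from the pencil. -/

theorem mainTheorem3 {F : Type*} [Field F] [IsAlgClosed F] (n m p ρA ρD : ℕ)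
    (R : Matrix (Fin p) (Fin m) (RatFunc F))
    (A : Matrix (Fin n) (Fin n) F[X]) (B : Matrix (Fin n) (Fin m) F[X])
    (C : Matrix (Fin p) (Fin n) F[X]) (D : Matrix (Fin p) (Fin m) F[X])
    (hA : A.det ≠ 0)
    (hR : R = matToRat D + matToRat C * (matToRat A)⁻¹ * matToRat B)
    -- the `(ρA + 1) n` columns of `L_A` are indexed by `Fin n ⊕ Fin (ρA * n)`,
    -- and the `(ρD + 1) m` columns of `L_D` by `Fin m ⊕ Fin (ρD * m)`
    (MA : Matrix (Fin n) (Fin n ⊕ Fin (ρA * n)) F[X])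
    (KA : Matrix (Fin (ρA * n)) (Fin n ⊕ Fin (ρA * n)) F[X])
    (NA : Matrix (Fin n) (Fin n ⊕ Fin (ρA * n)) F[X])
    (MD : Matrix (Fin p) (Fin m ⊕ Fin (ρD * m)) F[X])
    (KD : Matrix (Fin (ρD * m)) (Fin m ⊕ Fin (ρD * m)) F[X])
    (ND : Matrix (Fin m) (Fin m ⊕ Fin (ρD * m)) F[X])
    (hLA : IsStrongBlockMinimalBasisPencil MA KA NA ρA A)
    (hLD : IsStrongBlockMinimalBasisPencil MD KD ND ρD D)
    (MB : Matrix (Fin n) (Fin m ⊕ Fin (ρD * m)) F[X])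
    (MC : Matrix (Fin p) (Fin n ⊕ Fin (ρA * n)) F[X])
    (hMB : IsLinearMatrix MB) (hMC : IsLinearMatrix MC)
    (hC : MC * NA.transpose = C) (hB : MB * ND.transpose = B)
    (L : Matrix ((Fin n ⊕ Fin (ρA * n)) ⊕ (Fin p ⊕ Fin (ρD * m)))
      ((Fin n ⊕ Fin (ρA * n)) ⊕ (Fin m ⊕ Fin (ρD * m))) F[X])
    (hL : L = linearization MA KA MB MC MD KD)
    (Rhat : Matrix (Fin p ⊕ Fin (ρD * m)) (Fin m ⊕ Fin (ρD * m)) (RatFunc F))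
    (hRhat : Rhat = transferFunction L)
    (hfinite : ∀ a : F, (Matrix.fromRows (matEval a A) (matEval a C)).rank = n)
    (hinfinite : (Matrix.fromRows (matEval 0 (matRev (ρA + 1) A))
      (matEval 0 (matRev (ρA + 1) C))).rank = n) :
    (∀ (s : ℕ) (y : Fin s → (Fin n ⊕ Fin (ρA * n)) → F[X])
        (x : Fin s → (Fin m ⊕ Fin (ρD * m)) → F[X]),
      IsRightMinimalBasis (matToRat L) (fun i => Sum.elim (y i) (x i)) →
        IsRightMinimalBasis Rhat x ∧
          ∃ u : Fin s → Fin m → F[X],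
            IsRightMinimalBasis R u ∧ ∀ i, x i = ND.transpose.mulVec (u i)) ∧
    (∀ (s : ℕ) (ε : Fin s → ℕ), AreRightMinimalIndices (matToRat L) ε →
      AreRightMinimalIndices Rhat ε ∧
        (∀ i, ρD ≤ ε i) ∧ AreRightMinimalIndices R (fun i => ε i - ρD)) := by
  have hLdet : L.toBlocks₁₁.det ≠ 0 := by
    rw [hL]
    exact det_fromRows_ne_zero hLA.dual (by rwa [hLA.associated])
  have hSdet : (Matrix.fromBlocks A B (-C) D).toBlocks₁₁.det ≠ 0 := hA
  have hRS : transferFunction (Matrix.fromBlocks A B (-C) D) = R := by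
    rw [hR, transferFunction]
    simp [matToRat_neg, Matrix.neg_mul]
  have hnull : ∀ y x, (matToRat L).mulVec (Sum.elim y x) = 0 ↔
      ∃ w u, (matToRat NA.transpose).mulVec w = y ∧ (matToRat ND.transpose).mulVec u = x ∧
        (matToRat (Matrix.fromBlocks A B (-C) D)).mulVec (Sum.elim w u) = 0 := fun y x => by
    rw [hL, linearization_mulVec_eq_zero_iff hLA.dual hLD.dual, hLA.associated, hLD.associated,
      hC, hB]
  have hlift : ∀ x : Fin m ⊕ Fin (ρD * m) → F[X], vecToRat x ∈ rightNullSpace Rhat →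
      ∃ (y : Fin n ⊕ Fin (ρA * n) → F[X]) (w : Fin n → F[X]) (u : Fin m → F[X]),
        vecToRat (Sum.elim y x) = (nullVectorLift L).mulVec (vecToRat x) ∧
        ND.transpose.mulVec u = x ∧
        (matToRat (Matrix.fromBlocks A B (-C) D)).mulVec
          (Sum.elim (vecToRat w) (vecToRat u)) = 0 ∧
        vecDegree y ≤ vecDegree x := fun x hx => by
    have h0 := (matToRat_mulVec_elim_eq_zero_iff_nullVectorLift hLdet _ (vecToRat x)).2
      ⟨nullVectorLift_mulVec L _, by rw [← hRhat]; exact hx⟩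
    rw [hL] at h0
    obtain ⟨y, w, u, hy, hu, hS, hdeg⟩ := exists_polynomial_lift hLA hLD hMB hMC hC hB
      (by simpa using hfinite) (by simpa using hinfinite) h0
    refine ⟨y, w, u, ?_, hu, hS, hdeg⟩
    rw [vecToRat_elim, hy, nullVectorLift_mulVec, hL]
  -- Both inclusions pass through the full null vectors of the pencil and of the system matrix,
  -- whose transfer functions are `Rhat` and `R`.
  have hmapND : (rightNullSpace R).map (matToRat ND.transpose).mulVecLin =
      rightNullSpace Rhat := by
    ext x
    constructor
    · rintro ⟨u, hu, rfl⟩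
      have hS := (matToRat_mulVec_elim_eq_zero_iff_nullVectorLift hSdet _ u).2
        ⟨nullVectorLift_mulVec _ u, by rw [hRS]; exact hu⟩
      have := (matToRat_mulVec_elim_eq_zero_iff_nullVectorLift hLdet _ _).1
        ((hnull _ _).2 ⟨_, _, rfl, rfl, hS⟩)
      rw [hRhat]
      exact this.2
    · intro hx
      have h0 := (matToRat_mulVec_elim_eq_zero_iff_nullVectorLift hLdet _ x).2
        ⟨nullVectorLift_mulVec L _, by rw [← hRhat]; exact hx⟩
      obtain ⟨w, u, -, hu, hS⟩ := (hnull _ _).1 h0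
      have := ((matToRat_mulVec_elim_eq_zero_iff_nullVectorLift hSdet _ _).1 hS).2
      rw [hRS] at this
      exact ⟨u, this, hu⟩
  have hND : ∀ u : Fin m → F[X], u ≠ 0 →
      vecDegree (ND.transpose.mulVec u) = vecDegree u + ρD := fun u hu => by
    rw [vecDegree_mulVec (natDegree_le_of_vecDegree_eq hLD.rowDegree_dual)
      (hLD.dual.right_minimal.eq_zero_of_coeff_mulVec hLD.rowDegree_dual) hu, add_comm]
  have hmain : ∀ (s : ℕ) (b : Fin s → _ → F[X]), IsRightMinimalBasis (matToRat L) b →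
      IsRightMinimalBasis Rhat (fun i => b i ∘ Sum.inr) ∧
        (∀ i, vecDegree (b i) = vecDegree (b i ∘ Sum.inr)) ∧
        ∃ u : Fin s → Fin m → F[X], IsRightMinimalBasis R u ∧
          (∀ i, b i ∘ Sum.inr = ND.transpose.mulVec (u i)) ∧
          ∀ i, vecDegree (b i ∘ Sum.inr) = vecDegree (u i) + ρD := by
    intro s b hb
    have hbx : ∀ i, (nullVectorLift L).mulVec (vecToRat (b i ∘ Sum.inr)) = vecToRat (b i) ∧
        vecToRat (b i ∘ Sum.inr) ∈ rightNullSpace Rhat := fun i => by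
      have hmem : vecToRat (b i) ∈ rightNullSpace (matToRat L) := by
        rw [← hb.1.2]
        exact Submodule.subset_span ⟨i, rfl⟩
      rw [mem_rightNullSpace, ← Sum.elim_comp_inl_inr (vecToRat (b i)),
        matToRat_mulVec_elim_eq_zero_iff_nullVectorLift hLdet, ← hRhat,
        Sum.elim_comp_inl_inr] at hmem
      exact hmem
    -- The shift is `0`: the lifted vector `[y; x]` has the degree of `x`, since `deg y ≤ deg x`.
    obtain ⟨hx, hbdeg⟩ := IsMinimalBasis.of_map (V' := rightNullSpace Rhat)
      (nullVectorLift L).mulVecLin (by rw [ker_nullVectorLift]; exact disjoint_bot_right)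
      (by rw [hRhat, map_nullVectorLift hLdet]) 0
      (fun x hx _ => by
        obtain ⟨y, -, -, hy, -, -, hdeg⟩ := hlift x hx
        exact ⟨_, hy, by rw [vecDegree_elim, max_eq_right hdeg, add_zero]⟩)
      hb (fun i => (hbx i).2) (fun i => (hbx i).1)
    -- `hmapND` yields only rational preimages; the polynomial ones come from `hlift`.
    have hu : ∀ i, ∃ u, vecToRat u ∈ rightNullSpace R ∧
        ND.transpose.mulVec u = b i ∘ Sum.inr := fun i => by
      obtain ⟨-, w, u, -, hu, hS, -⟩ := hlift _ (hbx i).2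
      have := ((matToRat_mulVec_elim_eq_zero_iff_nullVectorLift hSdet _ _).1 hS).2
      rw [hRS] at this
      exact ⟨u, this, hu⟩
    choose u huR hu using hu
    obtain ⟨hu', hudeg⟩ := IsMinimalBasis.of_map (V' := rightNullSpace R)
      (matToRat ND.transpose).mulVecLin
      (by
        rw [LinearMap.ker_eq_bot'.2 fun w hw => hLD.dual.right_minimal.eq_zero_of_mulVec hw]
        exact disjoint_bot_right)
      hmapND ρD (fun v _ hv => ⟨_, vecToRat_mulVec _ _, hND v hv⟩)
      hx huR (fun i => by rw [← hu i, vecToRat_mulVec, Matrix.mulVecLin_apply])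
    exact ⟨hx, hbdeg, u, hu', fun i => (hu i).symm, hudeg⟩
  refine ⟨fun s y x h => ?_, ?_⟩
  · obtain ⟨hx, -, u, hu, hxu, -⟩ := hmain s _ h
    exact ⟨hx, u, hu, hxu⟩
  · rintro s ε ⟨hε, b, hb, hbε⟩
    obtain ⟨hx, hbx, u, hu, -, hxu⟩ := hmain s b hb
    -- This also shows `ρD ≤ ε i`, so the truncated subtraction `ε i - ρD` is a true difference.
    have hεu : ∀ i, ε i = vecDegree (u i) + ρD := fun i => by rw [← hbε, hbx, hxu]
    refine ⟨⟨hε, _, hx, fun i => by rw [← hbx, hbε]⟩, fun i => by rw [hεu]; exact le_add_self,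
      fun i j hij => Nat.sub_le_sub_right (hε hij) ρD, u, hu, fun i => ?_⟩
    simp only [hεu, Nat.add_sub_cancel]
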